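/- **Setting.** Let $(\mathbb K,|\cdot|)$ be a non-discrete valued field which is either ultrametric, or equal to $\mathbb R$ with an absolute value equivalent to the usual one $|\cdot|_{\mathbb R}$ (i.e. $|\cdot|=|\cdot|_{\mathbb R}^p$ with $0<p\le 1$). Let $(E,\|\cdot\|)\neq\{0\}$ be a Banach space over $\mathbb K$ and $A:E\to E$ a linear homeomorphism which is hyperbolic with $\|\cdot\|$ adapted to $A$: $E=E_s\oplus E_u$ with $A(E_s)\subseteq E_s$, $A(E_u)\subseteq E_u$, $\|x+y\|=\max\{\|x\|,\|y\|\}$ for $x\in E_s$, $y\in E_u$, and $a_s:=\|A|_{E_s}\|<1$, $a_u:=\|A^{-1}|_{E_u}\|<1$. Let $\alpha\in\,]0,1[$ and $\varepsilon,\delta>0$ satisfy, with $\kappa:=\|A^{-1}\|^{-1}$, $$\delta<\kappa,\qquad a_u(1+\delta)<1,\qquad a_s+\delta<1,$$ $$2a_u\delta+\varepsilon a_u(\|A\|+\delta)^\alpha+a_u\max\{\delta(1+\varepsilon),2\delta\}\le\varepsilon,$$ $$\frac{\varepsilon a_s}{(\kappa-\delta)^\alpha}+\max\Big\{\frac{\delta}{\kappa-\delta},2\delta\Big\}+\frac{\max\{\delta(1+\varepsilon),2\delta\}}{(\kappa-\delta)^\alpha}\le\varepsilon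 .$$ Write $B_t=\{x\in E:\|x\|<t\}$ and let $r>0$. In the ultrametric case put $s:=r$, $\rho:=\delta$, $\xi:=1$. If $\mathbb K=\mathbb R$, fix a function $\eta:[0,\infty[\to[0,1]$, Lipschitz for the ordinary absolute value, with $\eta=1$ on $[0,1]$ and $\eta=0$ on $[2,\infty[$, and put $s:=r/3$, $\rho:=\delta/(1+3\,\mathrm{Lip}(\eta))$, $\xi(y):=\eta(\|y\|/s)$. Let $\Omega$ be the set of all maps $g:E\to E$ with $\|g\|_\infty\le\delta$ and $\mathrm{Lip}(g)\le\delta$. Let $\tilde\Omega_0$ be the set of all maps $f:B_r\to E$ strictly differentiable at $0$ with $f(0)=0$, $f'(0)=A$, such that $R_f:=f-A|_{B_r}$ satisfies $\mathrm{Lip}(R_f)\le\rho$. For $f\in\tilde\Omega_0$ let $g_f:E\to E$ be $\xi R_f$ on $B_r$ and $0$ elsewhere. Let $\tilde\Omega:=\{f\in\tilde\Omega_0: g_f\in\Omega\}$, with the supremum metric $d_\infty$. Let $BC(E,E)$ be the space of bounded continuous maps with the supremum metric. Finally, let $\omega:[0,\infty[\to[0,\infty[$ be the bijection $\omega(a)=a+\varepsilon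 a^\alpha$, and let $O:=B_s$, $U:=B_{\omega^{-1}(s)}$, $W:=B_{\omega^{-1}(\omega^{-1}(s))}$. **Proposition 7.8.** 0. If $r\le1$ and either $\|\cdot\|$ is ultrametric (in the ultrametric case) or $|\cdot|$ is the usual absolute value (in the case $\mathbb K=\mathbb R$), then $\tilde\Omega=\tilde\Omega_0$. 1. For each $f\in\tilde\Omega$ there is a unique $\tilde v_f\in BC(E,E)$ with $(A+g_f)\circ(\mathrm{id}_E+\tilde v_f)=(\mathrm{id}_E+\tilde v_f)\circ A$. The map $H_f:=\mathrm{id}_E+\tilde v_f$ is a homeomorphism of $E$ onto $E$, and $H_f^{-1}=\mathrm{id}_E+\tilde w_f$ with $\tilde w_f\in BC(E,E)$. Moreover $W\subseteq H_f(U)\subseteq O$, $\;f\circ H_f|_U=H_f\circ A|_U$, and $H_f(0)=0$. 2. The map $f\mapsto\tilde v_f$ from $(\tilde\Omega,d_\infty)$ to $BC(E,E)$ is Lipschitz, and the map $f\mapsto\tilde w_f$ from $(\tilde\Omega,d_\infty)$ to $BC(E,E)$ is Hölder of exponent $\alpha$. 3. If $\mathbb K$ is locally compact and $\dim_{\mathbb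 K}E<\infty$, then for all $0<\beta<\alpha$ and $t>0$ the maps $f\mapsto\tilde v_f|_{B_t}$ and $f\mapsto\tilde w_f|_{B_t}$ from $(\tilde\Omega,d_\infty)$ to $BL_\beta(B_t,E)$ are continuous, where $BL_\beta(B_t,E)$ is the space of bounded maps $h:B_t\to E$ that are Hölder of exponent $\beta$, with norm $\max\{\|h\|_\infty,\mathrm{Lip}_\beta(h)\}$, and $\mathrm{Lip}_\beta(h)$ is the least constant $L\ge0$ with $\|h(x)-h(y)\|\le L\|x-y\|^\beta$ for all $x,y\in B_t$. -/

import Mathlib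

open Set Metric Topology
open scoped NNReal BoundedContinuousFunction

namespace GrobmanHartman

/-! ### Hölder maps and the Hölder spaces `BL_β(X, E)` -/

/-- `f` is Hölder of exponent `α` with constant `L`. -/
def HolderBound {X Y : Type*} [PseudoMetricSpace X] [PseudoMetricSpace Y]
    (L α : ℝ) (f : X → Y) : Prop :=
  ∀ x y, dist (f x) (f y) ≤ L * dist x y ^ α

/-- `Lip_α(f)`, the least nonnegative Hölder constant of exponent `α`
(meaningful when `f` is Hölder of exponent `α`). -/
noncomputable def holderConst {X Y : Type*} [PseudoMetricSpace X] [PseudoMetricSpace Y]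
    (α : ℝ) (f : X → Y) : ℝ :=
  sInf {L : ℝ | 0 ≤ L ∧ HolderBound L α f}

theorem holderConst_nonneg {X Y : Type*} [PseudoMetricSpace X] [PseudoMetricSpace Y]
    (α : ℝ) (f : X → Y) : 0 ≤ holderConst α f :=
  Real.sInf_nonneg fun _ h => h.1

theorem holderConst_le {X Y : Type*} [PseudoMetricSpace X] [PseudoMetricSpace Y]
    {α L : ℝ} {f : X → Y} (hL : 0 ≤ L) (h : HolderBound L α f) : holderConst α f ≤ L :=
  csInf_le ⟨0, fun _ h => h.1⟩ ⟨hL, h⟩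

theorem HolderBound.max_zero {X Y : Type*} [PseudoMetricSpace X] [PseudoMetricSpace Y]
    {α L : ℝ} {f : X → Y} (h : HolderBound L α f) : HolderBound (max L 0) α f := fun x y =>
  (h x y).trans (mul_le_mul_of_nonneg_right (le_max_left _ _) (by positivity))

/-- The infimum defining `Lip_α(f)` is attained. -/
theorem holderBound_holderConst {X Y : Type*} [PseudoMetricSpace X] [PseudoMetricSpace Y]
    {α : ℝ} {f : X → Y} (h : ∃ L, HolderBound L α f) : HolderBound (holderConst α f) α f := by
  obtain ⟨L, hL⟩ := h
  intro x y
  have h0 : 0 ≤ dist x y ^ α := by positivity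
  rcases h0.eq_or_lt with h0 | h0
  · have := hL x y
    rw [← h0, mul_zero] at this ⊢
    exact this
  · rw [← div_le_iff₀ h0]
    refine le_csInf ⟨max L 0, le_max_right _ _, hL.max_zero⟩ ?_
    rintro M ⟨-, hM⟩
    rw [div_le_iff₀ h0]
    exact hM x y

/-- The subgroup of bounded continuous maps that are Hölder of exponent `β`. -/
def holderSubgroup (β : ℝ) (X E : Type*) [MetricSpace X] [NormedAddCommGroup E] :
    AddSubgroup (X →ᵇ E) where
  carrier := {f | ∃ L, HolderBound L β f}
  zero_mem' := ⟨0, fun x y => by simp⟩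
  add_mem' := by
    rintro f g ⟨L, hL⟩ ⟨M, hM⟩
    refine ⟨L + M, fun x y => ?_⟩
    rw [add_mul]
    exact (dist_add_add_le _ _ _ _).trans (add_le_add (hL x y) (hM x y))
  neg_mem' := by
    rintro f ⟨L, hL⟩
    exact ⟨L, fun x y => by simpa using hL x y⟩

/-- The space `BL_β(X, E)` of bounded Hölder maps of exponent `β`. It carries the norm
`max {‖f‖_∞, Lip_β(f)}` and not the supremum norm. -/
def BL (β : ℝ) (X E : Type*) [MetricSpace X] [NormedAddCommGroup E] : Type _ :=
  holderSubgroup β X E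

namespace BL

variable {β : ℝ} {X E : Type*} [MetricSpace X] [NormedAddCommGroup E]

noncomputable instance : AddCommGroup (BL β X E) := inferInstanceAs (AddCommGroup (holderSubgroup β X E))

/-- The underlying bounded continuous map. -/
def toBC (f : BL β X E) : X →ᵇ E := Subtype.val f

/-- The norm `max {‖f‖_∞, Lip_β(f)}` on `BL_β(X, E)`. -/
noncomputable def groupNorm (β : ℝ) (X E : Type*) [MetricSpace X] [NormedAddCommGroup E] :
    AddGroupNorm (BL β X E) where
  toFun f := max ‖f.toBC‖ (holderConst β f.toBC)
  map_zero' := by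
    have h : holderConst β (⇑(0 : X →ᵇ E)) = 0 :=
      le_antisymm (holderConst_le le_rfl fun x y => by simp) (holderConst_nonneg _ _)
    change max ‖(0 : X →ᵇ E)‖ (holderConst β (⇑(0 : X →ᵇ E))) = 0
    rw [h, norm_zero, max_self]
  add_le' f g := by
    have hadd : (f + g).toBC = f.toBC + g.toBC := rfl
    have hf := holderBound_holderConst (Subtype.property f)
    have hg := holderBound_holderConst (Subtype.property g)
    have hfg : holderConst β (f + g).toBC
        ≤ holderConst β f.toBC + holderConst β g.toBC := by
      refine holderConst_le (add_nonneg (holderConst_nonneg _ _) (holderConst_nonneg _ _)) ?_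
      intro x y
      rw [add_mul]
      exact (dist_add_add_le _ _ _ _).trans (add_le_add (hf x y) (hg x y))
    refine max_le ?_ ?_
    · rw [hadd]
      exact (norm_add_le _ _).trans (add_le_add (le_max_left _ _) (le_max_left _ _))
    · exact hfg.trans (add_le_add (le_max_right _ _) (le_max_right _ _))
  neg' f := by
    have hneg : (-f).toBC = -f.toBC := rfl
    have hc : holderConst β (-f).toBC = holderConst β f.toBC := by
      simp [hneg, holderConst, HolderBound]
    rw [hc, hneg, norm_neg]
  eq_zero_of_map_eq_zero' f hf := by
    have h : ‖f.toBC‖ ≤ 0 := (le_max_left _ _).trans hf.le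
    exact Subtype.ext (norm_le_zero_iff.1 h)

noncomputable instance : NormedAddCommGroup (BL β X E) :=
  (groupNorm β X E).toNormedAddCommGroup

theorem norm_def (f : BL β X E) : ‖f‖ = max ‖f.toBC‖ (holderConst β f.toBC) := rfl

end BL

/-! ### Hyperbolic automorphisms -/

section Hyperbolic

variable {𝕂 E : Type*} [NontriviallyNormedField 𝕂] [NormedAddCommGroup E] [NormedSpace 𝕂 E]

/-- `‖A|_{E_s}‖`, the operator norm of the restriction of `A` to `E_s`. -/
noncomputable def normStable (A : E ≃L[𝕂] E) (Es : Submodule 𝕂 E) : ℝ :=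
  ‖(A : E →L[𝕂] E).comp Es.subtypeL‖

/-- `‖A⁻¹|_{E_u}‖`, the operator norm of the restriction of `A⁻¹` to `E_u`. -/
noncomputable def normUnstable (A : E ≃L[𝕂] E) (Eu : Submodule 𝕂 E) : ℝ :=
  ‖(A.symm : E →L[𝕂] E).comp Eu.subtypeL‖

/-- `A` is hyperbolic with respect to the splitting `E = E_s ⊕ E_u` into invariant subspaces,
and the given norm of `E` is adapted to `A`. -/
structure IsHyperbolic (A : E ≃L[𝕂] E) (Es Eu : Submodule 𝕂 E) : Prop where
  isCompl : IsCompl Es Eu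
  map_stable : ∀ x ∈ Es, A x ∈ Es
  map_unstable : ∀ x ∈ Eu, A x ∈ Eu
  norm_add : ∀ x ∈ Es, ∀ y ∈ Eu, ‖x + y‖ = max ‖x‖ ‖y‖
  stable_lt_one : normStable A Es < 1
  unstable_lt_one : normUnstable A Eu < 1

/-- The three smallness conditions relating `α`, `ε` and `δ`. -/
structure IsSmall (A : E ≃L[𝕂] E) (Es Eu : Submodule 𝕂 E) (α ε δ : ℝ) : Prop where
  lt_inv_norm : δ < ‖(A.symm : E →L[𝕂] E)‖⁻¹
  unstable_lt : normUnstable A Eu * (1 + δ) < 1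
  stable_lt : normStable A Es + δ < 1
  unstable_le : 2 * normUnstable A Eu * δ
      + ε * normUnstable A Eu * (‖(A : E →L[𝕂] E)‖ + δ) ^ α
      + normUnstable A Eu * max (δ * (1 + ε)) (2 * δ) ≤ ε
  stable_le : ε * normStable A Es / (‖(A.symm : E →L[𝕂] E)‖⁻¹ - δ) ^ α
      + max (δ / (‖(A.symm : E →L[𝕂] E)‖⁻¹ - δ)) (2 * δ)
      + max (δ * (1 + ε)) (2 * δ) / (‖(A.symm : E →L[𝕂] E)‖⁻¹ - δ) ^ α ≤ ε

/-- The set `Ω` of all maps `g : E → E` with `‖g‖_∞ ≤ δ` and `Lip(g) ≤ δ`. -/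
def smallMaps (E : Type*) [NormedAddCommGroup E] (δ : ℝ) : Set (E → E) :=
  {g | (∀ x, ‖g x‖ ≤ δ) ∧ ∀ x y, ‖g x - g y‖ ≤ δ * ‖x - y‖}

/-- The equation `(A + g) ∘ (id + v) = (id + v) ∘ A`. -/
def IsConjugating (A : E ≃L[𝕂] E) (g v : E → E) : Prop :=
  ∀ x, A (x + v x) + g (x + v x) = A x + v (A x)

end Hyperbolic

/-! ### Cutting off the nonlinearity -/

/-- A Lipschitz function `η : [0, ∞[ → [0, 1]` equal to `1` on `[0, 1]` and to `0` on `[2, ∞[`. -/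
structure IsCutoffProfile (η : ℝ≥0 → ℝ) : Prop where
  mem_Icc : ∀ t, η t ∈ Icc (0 : ℝ) 1
  eq_one : ∀ t ≤ 1, η t = 1
  eq_zero : ∀ t, 2 ≤ t → η t = 0
  lipschitz : ∃ L, HolderBound L 1 η

/-- The two kinds of ground fields. Either the valued field `𝕂` is ultrametric, or `𝕂` is the
field of real numbers with an absolute value equivalent to the usual one: there is an isomorphism
`e` of topological fields from `𝕂` onto `ℝ`. In the real case a profile `η` is fixed as well. -/
inductive GroundCase (𝕂 : Type*) [NontriviallyNormedField 𝕂] : Type _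
  | ultrametric (h : IsUltrametricDist 𝕂) : GroundCase 𝕂
  | real (e : 𝕂 ≃+* ℝ) (he : IsHomeomorph e) (η : ℝ≥0 → ℝ) (hη : IsCutoffProfile η) :
      GroundCase 𝕂

namespace GroundCase

variable {𝕂 : Type*} [NontriviallyNormedField 𝕂]

/-- The radius `s`: `s = r` in the ultrametric case and `s = r / 3` in the real case. -/
noncomputable def radius (c : GroundCase 𝕂) (r : ℝ) : ℝ :=
  match c with
  | ultrametric _ => r
  | real _ _ _ _ => r / 3

/-- The bound imposed on `Lip(R_f)`: `δ` in the ultrametric case and `δ / (1 + 3 Lip(η))` in the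
real case. -/
noncomputable def lipBound (c : GroundCase 𝕂) (δ : ℝ) : ℝ :=
  match c with
  | ultrametric _ => δ
  | real _ _ η _ => δ / (1 + 3 * holderConst 1 η)

/-- The scalar factor in the cut-off: `1` in the ultrametric case and
`ξ_s(y) = η(‖y‖ / s)`, viewed as an element of `𝕂`, in the real case. -/
noncomputable def factor {E : Type*} [NormedAddCommGroup E] (c : GroundCase 𝕂) (s : ℝ) (y : E) :
    𝕂 :=
  match c with
  | ultrametric _ => 1
  | real e _ η _ => e.symm (η (‖y‖ / s).toNNReal)

/-- The norm of `E` is ultrametric (if `𝕂` is ultrametric), respectively the absolute value of `𝕂`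
is the usual absolute value of `ℝ`. -/
def IsStandard (E : Type*) [NormedAddCommGroup E] (c : GroundCase 𝕂) : Prop :=
  match c with
  | ultrametric _ => IsUltrametricDist E
  | real e _ _ _ => ∀ x : 𝕂, ‖x‖ = |e x|

end GroundCase

section Local

variable {𝕂 E : Type*} [NontriviallyNormedField 𝕂] [NormedAddCommGroup E] [NormedSpace 𝕂 E]

open Classical in
/-- Extension by zero of a map defined on the ball `B_r(0)`. -/
noncomputable def zeroExtend {r : ℝ} (f : ball (0 : E) r → E) (y : E) : E :=
  if h : y ∈ ball (0 : E) r then f ⟨y, h⟩ else 0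

/-- The nonlinearity `R_f = f - A` on the ball. -/
def nonlinearity {r : ℝ} (A : E ≃L[𝕂] E) (f : ball (0 : E) r → E) (y : ball (0 : E) r) : E :=
  f y - A y

/-- The cut-off nonlinearity `g_f`: it is `R_f` (ultrametric case) respectively `ξ_s R_f`
with `s = r / 3` (real case) on `B_r(0)`, and `0` elsewhere. -/
noncomputable def cutoff {r : ℝ} (c : GroundCase 𝕂) (A : E ≃L[𝕂] E) (f : ball (0 : E) r → E)
    (y : E) : E :=
  c.factor (c.radius r) y • zeroExtend (nonlinearity A f) y

/-- The maps `f : B_r(0) → E` which are strictly differentiable at `0` with `f(0) = 0` and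
`f'(0) = A`, and such that `Lip(R_f)` satisfies the bound of the respective case. Such maps are
automatically bounded and continuous, and the metric of `ball 0 r →ᵇ E` is the supremum metric. -/
def localMaps (c : GroundCase 𝕂) (A : E ≃L[𝕂] E) (r δ : ℝ) : Set (ball (0 : E) r →ᵇ E) :=
  {f | zeroExtend f 0 = 0 ∧ HasStrictFDerivAt (zeroExtend f) (A : E →L[𝕂] E) 0 ∧
    ∀ y z, ‖nonlinearity A f y - nonlinearity A f z‖ ≤ c.lipBound δ * ‖(y : E) - z‖}

/-- The members `f` of `localMaps` whose cut-off nonlinearity `g_f` belongs to `Ω`, so that the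
conjugacy for `A + g_f` is available. -/
def admissibleMaps (c : GroundCase 𝕂) (A : E ≃L[𝕂] E) (r δ : ℝ) : Set (ball (0 : E) r →ᵇ E) :=
  {f | f ∈ localMaps c A r δ ∧ cutoff c A f ∈ smallMaps E δ}

end Local

/-- The function `ω(a) = a + ε a ^ α` on `[0, ∞[`. -/
noncomputable def omega (ε α a : ℝ) : ℝ := a + ε * a ^ α

/-- The inverse of the bijection `ω : [0, ∞[ → [0, ∞[`. -/
noncomputable def omegaInv (ε α t : ℝ) : ℝ := Function.invFunOn (omega ε α) (Ici 0) t

end GrobmanHartman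

open GrobmanHartman

/-! More generally, one conjugates `A + g` to `A + h` for small `g`, `h`. With `B = A + g`, the
equation for `id + v` reads `A v + h ∘ (id + v) - g = v ∘ B`. It becomes a fixed-point equation
after splitting along `E_s ⊕ E_u`: the stable component is precomposed with `B⁻¹`, so that `A`
contracts, and `A⁻¹`, which contracts `E_u`, is applied to the unstable component. Since the norm is
the maximum over the components, the operator contracts the bounded continuous maps with factor `θ =
max (a_u (1 + δ)) (a_s + δ) < 1` (`norm_intertwiningOperator_sub_le`).

This gives existence and uniqueness. By uniqueness, the solutions for the pairs `(0, g_f)` and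
`(g_f, 0)` define mutually inverse maps (`add_apply_add_of_intertwines`). The smallness conditions
say that the operator preserves the estimate `‖v x - v y‖ ≤ ε ‖x - y‖ ^ α`, which therefore passes
to the fixed point (`norm_intertwiningOperator_sub_le_rpow`).

The contraction estimate also shows that `v` is Lipschitz in the perturbation. For `w`, the
homeomorphism `B` itself would vary with `f`; instead, `w` is compared through the inverse relation
and its Hölder bound (`norm_inverse_sub_le`), hence the exponent `α`. Since `v` and `w` vanish at
`0`, their Hölder bounds yield the inclusions between balls through `ω`. Interpolating between the
supremum norm and the uniform `α`-Hölder bound gives continuity into `BL_β`. -/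

namespace GrobmanHartman

variable {𝕂 E : Type*} [NontriviallyNormedField 𝕂] [NormedAddCommGroup E] [NormedSpace 𝕂 E]
variable {A : E ≃L[𝕂] E} {Es Eu : Submodule 𝕂 E}

/-! ### The projections of a hyperbolic splitting -/

namespace IsHyperbolic

/-- The continuous projection onto `E_s` along `E_u`. -/
noncomputable def stableProj (hA : IsHyperbolic A Es Eu) : E →L[𝕂] E :=
  (Es.projection Eu hA.isCompl).mkContinuous 1 fun x => by
    have h := hA.norm_add _ (Submodule.projection_apply_mem hA.isCompl x) _
      (Submodule.projection_apply_mem hA.isCompl.symm x)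
    rw [Submodule.projection_add_projection_eq_self] at h
    rw [one_mul, h]
    exact le_max_left _ _

/-- The continuous projection onto `E_u` along `E_s`. -/
noncomputable def unstableProj (hA : IsHyperbolic A Es Eu) : E →L[𝕂] E :=
  (Eu.projection Es hA.isCompl.symm).mkContinuous 1 fun x => by
    have h := hA.norm_add _ (Submodule.projection_apply_mem hA.isCompl x) _
      (Submodule.projection_apply_mem hA.isCompl.symm x)
    rw [Submodule.projection_add_projection_eq_self] at h
    rw [one_mul, h]
    exact le_max_right _ _

variable (hA : IsHyperbolic A Es Eu)

theorem stableProj_mem (x : E) : hA.stableProj x ∈ Es :=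
  Submodule.projection_apply_mem hA.isCompl x

theorem unstableProj_mem (x : E) : hA.unstableProj x ∈ Eu :=
  Submodule.projection_apply_mem hA.isCompl.symm x

theorem stableProj_add_unstableProj (x : E) : hA.stableProj x + hA.unstableProj x = x :=
  Submodule.projection_add_projection_eq_self hA.isCompl x

theorem stableProj_of_mem {x : E} (hx : x ∈ Es) : hA.stableProj x = x :=
  Submodule.projection_apply_left hA.isCompl ⟨x, hx⟩

theorem stableProj_of_mem_unstable {x : E} (hx : x ∈ Eu) : hA.stableProj x = 0 :=
  Submodule.projection_apply_right hA.isCompl ⟨x, hx⟩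

theorem unstableProj_of_mem {x : E} (hx : x ∈ Eu) : hA.unstableProj x = x :=
  Submodule.projection_apply_left hA.isCompl.symm ⟨x, hx⟩

theorem unstableProj_of_mem_stable {x : E} (hx : x ∈ Es) : hA.unstableProj x = 0 :=
  Submodule.projection_apply_right hA.isCompl.symm ⟨x, hx⟩

theorem norm_eq_max (x : E) : ‖x‖ = max ‖hA.stableProj x‖ ‖hA.unstableProj x‖ := by
  rw [← hA.norm_add _ (hA.stableProj_mem x) _ (hA.unstableProj_mem x),
    hA.stableProj_add_unstableProj]

theorem norm_stableProj_le (x : E) : ‖hA.stableProj x‖ ≤ ‖x‖ := by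
  rw [hA.norm_eq_max x]
  exact le_max_left _ _

theorem norm_unstableProj_le (x : E) : ‖hA.unstableProj x‖ ≤ ‖x‖ := by
  rw [hA.norm_eq_max x]
  exact le_max_right _ _

theorem norm_le_of_proj_le {x : E} {c : ℝ} (hs : ‖hA.stableProj x‖ ≤ c)
    (hu : ‖hA.unstableProj x‖ ≤ c) : ‖x‖ ≤ c := by
  rw [hA.norm_eq_max x]
  exact max_le hs hu

theorem stableProj_map (x : E) : hA.stableProj (A x) = A (hA.stableProj x) := by
  conv_lhs => rw [← hA.stableProj_add_unstableProj x, map_add, map_add]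
  rw [hA.stableProj_of_mem (hA.map_stable _ (hA.stableProj_mem x)),
    hA.stableProj_of_mem_unstable (hA.map_unstable _ (hA.unstableProj_mem x)), add_zero]

theorem unstableProj_map (x : E) : hA.unstableProj (A x) = A (hA.unstableProj x) := by
  conv_lhs => rw [← hA.stableProj_add_unstableProj x, map_add, map_add]
  rw [hA.unstableProj_of_mem_stable (hA.map_stable _ (hA.stableProj_mem x)),
    hA.unstableProj_of_mem (hA.map_unstable _ (hA.unstableProj_mem x)), zero_add]

/-- Deduced from the commutation with `A`; it shows that `A⁻¹` also preserves `E_u`, although only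
invariance under `A` is assumed. -/
theorem unstableProj_symm (x : E) : hA.unstableProj (A.symm x) = A.symm (hA.unstableProj x) := by
  apply A.injective
  rw [← hA.unstableProj_map, A.apply_symm_apply, A.apply_symm_apply]

theorem norm_map_stableProj_le (x : E) : ‖hA.stableProj (A x)‖ ≤ normStable A Es * ‖x‖ := by
  rw [hA.stableProj_map]
  refine (((A : E →L[𝕂] E).comp Es.subtypeL).le_opNorm
    ⟨hA.stableProj x, hA.stableProj_mem x⟩).trans ?_
  exact mul_le_mul_of_nonneg_left (hA.norm_stableProj_le x) (norm_nonneg _)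

theorem norm_symm_unstableProj_le (x : E) :
    ‖A.symm (hA.unstableProj x)‖ ≤ normUnstable A Eu * ‖x‖ := by
  refine (((A.symm : E →L[𝕂] E).comp Eu.subtypeL).le_opNorm
    ⟨hA.unstableProj x, hA.unstableProj_mem x⟩).trans ?_
  exact mul_le_mul_of_nonneg_left (hA.norm_unstableProj_le x) (norm_nonneg _)

end IsHyperbolic

theorem normStable_nonneg : 0 ≤ normStable A Es := norm_nonneg _

theorem normUnstable_nonneg : 0 ≤ normUnstable A Eu := norm_nonneg _

/-! ### Perturbations of the linear automorphism -/

theorem zero_mem_smallMaps {δ : ℝ} (hδ : 0 ≤ δ) : (0 : E → E) ∈ smallMaps E δ :=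
  ⟨fun x => by simpa using hδ, fun x y => by simpa using by positivity⟩

theorem continuous_of_norm_sub_le {g : E → E} {δ : ℝ}
    (hg : ∀ x y, ‖g x - g y‖ ≤ δ * ‖x - y‖) : Continuous g :=
  (LipschitzWith.of_dist_le_mul (K := δ.toNNReal) fun x y => by
    rw [dist_eq_norm, dist_eq_norm]
    exact (hg x y).trans (mul_le_mul_of_nonneg_right (Real.le_coe_toNNReal δ)
      (norm_nonneg _))).continuous

/-- `A` expands distances by at least `κ = ‖A⁻¹‖⁻¹` and `g` changes them by at most the factor `δ <
κ`, so `A + g` still expands by `κ - δ`. -/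
theorem exists_homeomorph_add [CompleteSpace E] [Nontrivial E] {δ : ℝ}
    (hδ : 0 ≤ δ) (hlt : δ < ‖(A.symm : E →L[𝕂] E)‖⁻¹) {g : E → E}
    (hg : ∀ x y, ‖g x - g y‖ ≤ δ * ‖x - y‖) :
    ∃ B : E ≃ₜ E, (∀ x, B x = A x + g x) ∧
      ∀ x y, ‖B.symm x - B.symm y‖ ≤ ‖x - y‖ / (‖(A.symm : E →L[𝕂] E)‖⁻¹ - δ) := by
  have happ : ApproximatesLinearOn (fun x => A x + g x) (A : E →L[𝕂] E) univ ⟨δ, hδ⟩ := by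
    intro x _ y _
    have : A x + g x - (A y + g y) - (A : E →L[𝕂] E) (x - y) = g x - g y := by
      rw [map_sub]
      simp only [ContinuousLinearEquiv.coe_coe]
      abel
    rw [this]
    exact hg x y
  have hlt' : (⟨δ, hδ⟩ : ℝ≥0) < ‖(A.symm : E →L[𝕂] E)‖₊⁻¹ := hlt
  refine ⟨happ.toHomeomorph _ (Or.inr hlt'), fun x => rfl, fun x y => ?_⟩
  obtain ⟨x, rfl⟩ := (happ.toHomeomorph _ (Or.inr hlt')).surjective x
  obtain ⟨y, rfl⟩ := (happ.toHomeomorph _ (Or.inr hlt')).surjective y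
  rw [Homeomorph.symm_apply_apply, Homeomorph.symm_apply_apply, le_div_iff₀ (sub_pos.2 hlt)]
  change ‖x - y‖ * _ ≤ ‖A x + g x - (A y + g y)‖
  -- As `0⁻¹ = 0`, a vanishing norm would force `δ < 0`.
  have hN : 0 < ‖(A.symm : E →L[𝕂] E)‖ := by
    by_contra! h
    rw [le_antisymm h (norm_nonneg _), inv_zero] at hlt
    linarith
  have h1 : ‖x - y‖ ≤ ‖(A.symm : E →L[𝕂] E)‖ * ‖A (x - y)‖ := by
    simpa using (A.symm : E →L[𝕂] E).le_opNorm (A (x - y))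
  have h2 : ‖x - y‖ * ‖(A.symm : E →L[𝕂] E)‖⁻¹ ≤ ‖A (x - y)‖ := by
    rw [← div_eq_mul_inv, div_le_iff₀ hN, mul_comm]
    exact h1
  have h3 : ‖A (x - y)‖ ≤ ‖A x + g x - (A y + g y)‖ + ‖g x - g y‖ := by
    have : A (x - y) = A x + g x - (A y + g y) - (g x - g y) := by
      rw [map_sub]
      abel
    rw [this]
    exact norm_sub_le _ _
  have := hg x y
  linarith

/-- The equation `(A + h) ∘ (id + v) = (id + v) ∘ (A + g)`. -/
def Intertwines (A : E ≃L[𝕂] E) (g h v : E → E) : Prop :=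
  ∀ x, A (x + v x) + h (x + v x) = A x + g x + v (A x + g x)

theorem isConjugating_iff_intertwines {h v : E → E} :
    IsConjugating A h v ↔ Intertwines A 0 h v := by
  simp [IsConjugating, Intertwines]

/-- The common contraction factor of the stable and the unstable component. -/
noncomputable def contractionFactor (A : E ≃L[𝕂] E) (Es Eu : Submodule 𝕂 E) (δ : ℝ) : ℝ :=
  max (normUnstable A Eu * (1 + δ)) (normStable A Es + δ)

theorem IsSmall.contractionFactor_lt_one {α ε δ : ℝ} (hs : IsSmall A Es Eu α ε δ) :
    contractionFactor A Es Eu δ < 1 :=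
  max_lt hs.unstable_lt hs.stable_lt

theorem contractionFactor_nonneg {δ : ℝ} (hδ : 0 ≤ δ) : 0 ≤ contractionFactor A Es Eu δ :=
  (add_nonneg normStable_nonneg hδ).trans (le_max_right _ _)

/-! ### The fixed-point operator and its contraction property -/

section Operator

variable (hA : IsHyperbolic A Es Eu)

/-- The operator whose fixed points are the solutions of `Intertwines A g h`. Here `B` stands
for `A + g`. -/
noncomputable def intertwiningOperator (B : E ≃ₜ E) (g h v : E → E) (x : E) : E :=
  A.symm (hA.unstableProj (g x + v (B x) - h (x + v x)))
    + hA.stableProj (A (v (B.symm x)) + h (B.symm x + v (B.symm x)) - g (B.symm x))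

theorem unstableProj_intertwiningOperator (B : E ≃ₜ E) (g h v : E → E) (x : E) :
    hA.unstableProj (intertwiningOperator hA B g h v x)
      = A.symm (hA.unstableProj (g x + v (B x) - h (x + v x))) := by
  rw [intertwiningOperator, map_add, hA.unstableProj_of_mem_stable (hA.stableProj_mem _), add_zero,
    hA.unstableProj_symm, hA.unstableProj_of_mem (hA.unstableProj_mem _)]

theorem stableProj_intertwiningOperator (B : E ≃ₜ E) (g h v : E → E) (x : E) :
    hA.stableProj (intertwiningOperator hA B g h v x)
      = hA.stableProj (A (v (B.symm x)) + h (B.symm x + v (B.symm x)) - g (B.symm x)) := by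
  rw [intertwiningOperator, map_add, ← hA.unstableProj_symm,
    hA.stableProj_of_mem_unstable (hA.unstableProj_mem _), zero_add,
    hA.stableProj_of_mem (hA.stableProj_mem _)]

theorem intertwines_iff_fixed {B : E ≃ₜ E} {g h v : E → E} (hB : ∀ x, B x = A x + g x) :
    Intertwines A g h v ↔ ∀ x, intertwiningOperator hA B g h v x = v x := by
  have key : Intertwines A g h v ↔ ∀ x, A (v x) + h (x + v x) - g x = v (B x) := by
    refine forall_congr' fun x => ?_
    rw [hB, map_add, sub_eq_iff_eq_add, ← sub_eq_zero, ← sub_eq_zero (b := _ + g x)]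
    have : A x + A (v x) + h (x + v x) - (A x + g x + v (A x + g x))
      = A (v x) + h (x + v x) - (v (A x + g x) + g x) := by abel
    rw [this]
  rw [key]
  constructor
  · intro hv x
    rw [intertwiningOperator, hv (B.symm x), B.apply_symm_apply, ← hv x]
    have : g x + (A (v x) + h (x + v x) - g x) - h (x + v x) = A (v x) := by abel
    rw [this, ← hA.unstableProj_symm, A.symm_apply_apply, add_comm,
      hA.stableProj_add_unstableProj]
  · intro hv x
    -- The unstable component is read at `x` and multiplied by `A`; the stable one is read at `B x`,
    -- where `B.symm` cancels. Together they recover both components of the equation at `x`.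
    have hu := congrArg hA.unstableProj (hv x)
    have hs := congrArg hA.stableProj (hv (B x))
    rw [unstableProj_intertwiningOperator] at hu
    rw [stableProj_intertwiningOperator, B.symm_apply_apply] at hs
    replace hu := congrArg A hu
    rw [A.apply_symm_apply, ← hA.unstableProj_map] at hu
    rw [← hA.stableProj_add_unstableProj (v (B x)),
      ← hA.stableProj_add_unstableProj (A (v x) + h (x + v x) - g x), hs]
    congr 1
    simp only [map_sub, map_add, ← hu]
    abel

/-- Varying `h` together with `v` lets one estimate serve for contraction (`D = 0`), uniqueness and
dependence on the perturbation. The map `g` stays fixed because `B` depends on it. -/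
theorem norm_intertwiningOperator_sub_le {δ : ℝ} (B : E ≃ₜ E) {g h h' : E → E} {u v : E → E}
    (hh : ∀ x y, ‖h x - h y‖ ≤ δ * ‖x - y‖) (hδ : 0 ≤ δ) {C D : ℝ}
    (huv : ∀ x, ‖u x - v x‖ ≤ C) (hD : ∀ x, ‖h x - h' x‖ ≤ D) (x : E) :
    ‖intertwiningOperator hA B g h u x - intertwiningOperator hA B g h' v x‖
      ≤ contractionFactor A Es Eu δ * C + D := by
  have hC : 0 ≤ C := (norm_nonneg _).trans (huv 0)
  have hD0 : 0 ≤ D := (norm_nonneg _).trans (hD 0)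
  have hdiff : ∀ y, ‖h (y + u y) - h' (y + v y)‖ ≤ δ * C + D := fun y => by
    have e : h (y + u y) - h' (y + v y)
      = (h (y + u y) - h (y + v y)) + (h (y + v y) - h' (y + v y)) := by abel
    rw [e]
    refine (norm_add_le _ _).trans (add_le_add ((hh _ _).trans ?_) (hD _))
    rw [add_sub_add_left_eq_sub]
    exact mul_le_mul_of_nonneg_left (huv y) hδ
  refine hA.norm_le_of_proj_le ?_ ?_
  · rw [map_sub, stableProj_intertwiningOperator, stableProj_intertwiningOperator, ← map_sub]
    set y := B.symm x
    have e : A (u y) + h (y + u y) - g y - (A (v y) + h' (y + v y) - g y)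
      = A (u y - v y) + (h (y + u y) - h' (y + v y)) := by
      rw [map_sub]
      abel
    rw [e, map_add]
    have h1 := (hA.norm_map_stableProj_le (u y - v y)).trans
      (mul_le_mul_of_nonneg_left (huv y) normStable_nonneg)
    have h2 := (hA.norm_stableProj_le _).trans (hdiff y)
    have h3 : (normStable A Es + δ) * C ≤ contractionFactor A Es Eu δ * C :=
      mul_le_mul_of_nonneg_right (le_max_right _ _) hC
    have h4 := norm_add_le (hA.stableProj (A (u y - v y)))
      (hA.stableProj (h (y + u y) - h' (y + v y)))
    linarith
  · rw [map_sub, unstableProj_intertwiningOperator, unstableProj_intertwiningOperator, ← map_sub,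
      ← map_sub]
    have e : g x + u (B x) - h (x + u x) - (g x + v (B x) - h' (x + v x))
      = (u (B x) - v (B x)) - (h (x + u x) - h' (x + v x)) := by abel
    rw [e]
    refine (hA.norm_symm_unstableProj_le _).trans ?_
    have h1 := (norm_sub_le (u (B x) - v (B x)) (h (x + u x) - h' (x + v x))).trans
      (add_le_add (huv (B x)) (hdiff x))
    have h2 := mul_le_mul_of_nonneg_left h1 (normUnstable_nonneg (A := A) (Eu := Eu))
    have h3 : (normUnstable A Eu * (1 + δ)) * C ≤ contractionFactor A Es Eu δ * C :=
      mul_le_mul_of_nonneg_right (le_max_left _ _) hC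
    have h4 : normUnstable A Eu * D ≤ 1 * D :=
      mul_le_mul_of_nonneg_right hA.unstable_lt_one.le hD0
    linarith

end Operator

/-! ### Existence, uniqueness and Hölder continuity of the conjugating maps -/

/-- For `d ≤ 1` the Lipschitz bound is used, for `d ≥ 1` the bound `2δ` on the oscillation, since
then `1 ≤ d ^ α`. This is the origin of the maxima in `IsSmall`. -/
theorem norm_sub_le_rpow_of_mem_smallMaps {g : E → E} {δ : ℝ} (hg : g ∈ smallMaps E δ)
    (hδ : 0 ≤ δ) {α c d : ℝ} {a b : E} (hα : 0 ≤ α) (hd : 0 ≤ d)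
    (hab : d ≤ 1 → ‖a - b‖ ≤ c * d ^ α) :
    ‖g a - g b‖ ≤ max (δ * c) (2 * δ) * d ^ α := by
  have hdα : 0 ≤ d ^ α := Real.rpow_nonneg hd α
  rcases le_total d 1 with h | h
  · calc ‖g a - g b‖ ≤ δ * (c * d ^ α) := (hg.2 a b).trans (mul_le_mul_of_nonneg_left (hab h) hδ)
      _ = δ * c * d ^ α := by ring
      _ ≤ _ := mul_le_mul_of_nonneg_right (le_max_left _ _) hdα
  · calc ‖g a - g b‖ ≤ 2 * δ * 1 := by
          have := (norm_sub_le (g a) (g b)).trans (add_le_add (hg.1 a) (hg.1 b))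
          linarith
      _ ≤ 2 * δ * d ^ α :=
          mul_le_mul_of_nonneg_left (Real.one_le_rpow h hα) (by linarith)
      _ ≤ _ := mul_le_mul_of_nonneg_right (le_max_right _ _) hdα

/-! ### Boundedness and Hölder estimates for the operator -/

section Operator

variable (hA : IsHyperbolic A Es Eu)

theorem norm_intertwiningOperator_le {δ : ℝ} (B : E ≃ₜ E) {g h v : E → E}
    (hg : ∀ x, ‖g x‖ ≤ δ) (hh : ∀ x, ‖h x‖ ≤ δ) {C : ℝ} (hv : ∀ x, ‖v x‖ ≤ C) (x : E) :
    ‖intertwiningOperator hA B g h v x‖ ≤ C + 2 * δ := by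
  have hC : 0 ≤ C := (norm_nonneg _).trans (hv 0)
  have hδ : 0 ≤ δ := (norm_nonneg _).trans (hg 0)
  refine hA.norm_le_of_proj_le ?_ ?_
  · rw [stableProj_intertwiningOperator, add_sub_assoc, map_add]
    have h1 := (hA.norm_map_stableProj_le (v (B.symm x))).trans
      (mul_le_mul hA.stable_lt_one.le (hv _) (norm_nonneg _) zero_le_one)
    have h2 := (hA.norm_stableProj_le _).trans ((norm_sub_le
      (h (B.symm x + v (B.symm x))) (g (B.symm x))).trans (add_le_add (hh _) (hg _)))
    refine (norm_add_le _ _).trans ?_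
    linarith
  · rw [unstableProj_intertwiningOperator]
    refine (hA.norm_symm_unstableProj_le _).trans ((mul_le_mul hA.unstable_lt_one.le
      (?_ : _ ≤ C + 2 * δ) (norm_nonneg _) zero_le_one).trans (one_mul _).le)
    have := (norm_sub_le (g x + v (B x)) (h (x + v x))).trans
      (add_le_add ((norm_add_le _ _).trans (add_le_add (hg x) (hv (B x)))) (hh _))
    linarith

/-- The stable component uses `stable_le`, with `κ - δ` coming from the Lipschitz constant of `B⁻¹`;
the unstable one uses `unstable_le`, with `‖A‖ + δ` bounding that of `B`. -/
theorem norm_intertwiningOperator_sub_le_rpow {α ε δ : ℝ} (hs : IsSmall A Es Eu α ε δ)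
    (hα0 : 0 < α) (hα1 : α < 1) (hε : 0 ≤ ε) (hδ : 0 ≤ δ) {B : E ≃ₜ E} {g h v : E → E}
    (hg : g ∈ smallMaps E δ) (hh : h ∈ smallMaps E δ) (hB : ∀ x, B x = A x + g x)
    (hB' : ∀ x y, ‖B.symm x - B.symm y‖ ≤ ‖x - y‖ / (‖(A.symm : E →L[𝕂] E)‖⁻¹ - δ))
    (hv : ∀ x y, ‖v x - v y‖ ≤ ε * ‖x - y‖ ^ α) (x y : E) :
    ‖intertwiningOperator hA B g h v x - intertwiningOperator hA B g h v y‖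
      ≤ ε * ‖x - y‖ ^ α := by
  set m := ‖(A.symm : E →L[𝕂] E)‖⁻¹ - δ
  have hm : 0 < m := sub_pos.2 hs.lt_inv_norm
  have hmα : 0 < m ^ α := Real.rpow_pos_of_pos hm α
  have hle : ∀ {d : ℝ}, 0 ≤ d → d ≤ 1 → d ≤ d ^ α := fun h0 h1 =>
    Real.self_le_rpow_of_le_one h0 h1 hα1.le
  -- For `‖a - b‖ ≤ 1` one has `‖a - b‖ ≤ ‖a - b‖ ^ α`, so `id + v` satisfies an `α`-Hölder bound
  -- with constant `1 + ε` at such distances.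
  have hnl : ∀ a b : E, ‖h (a + v a) - h (b + v b)‖
      ≤ max (δ * (1 + ε)) (2 * δ) * ‖a - b‖ ^ α := fun a b => by
    refine norm_sub_le_rpow_of_mem_smallMaps hh hδ hα0.le (norm_nonneg _) fun h1 => ?_
    rw [add_sub_add_comm]
    have := norm_add_le (a - b) (v a - v b)
    have := hv a b
    have := hle (norm_nonneg (a - b)) h1
    linarith
  set d := ‖x - y‖
  have hd : 0 ≤ d := norm_nonneg _
  refine hA.norm_le_of_proj_le ?_ ?_
  · rw [map_sub, stableProj_intertwiningOperator, stableProj_intertwiningOperator, ← map_sub]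
    have hxy : ‖B.symm x - B.symm y‖ ^ α ≤ d ^ α / m ^ α := by
      rw [← Real.div_rpow hd hm.le]
      exact Real.rpow_le_rpow (norm_nonneg _) (hB' x y) hα0.le
    have h3 : ‖g (B.symm x) - g (B.symm y)‖ ≤ max (δ / m) (2 * δ) * d ^ α := by
      have := norm_sub_le_rpow_of_mem_smallMaps (a := B.symm x) (b := B.symm y) (c := 1 / m)
        hg hδ hα0.le hd fun h1 => ?_
      · rwa [mul_one_div] at this
      · refine (hB' x y).trans ?_
        rw [one_div_mul_eq_div]
        exact div_le_div_of_nonneg_right (hle hd h1) hm.le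
    have h2 := hnl (B.symm x) (B.symm y)
    have h1 := hv (B.symm x) (B.symm y)
    set a := B.symm x
    set b := B.symm y
    have e : A (v a) + h (a + v a) - g a - (A (v b) + h (b + v b) - g b)
      = A (v a - v b) + ((h (a + v a) - h (b + v b)) - (g a - g b)) := by
      rw [map_sub]
      abel
    rw [e, map_add]
    have h1' : ‖hA.stableProj (A (v a - v b))‖ ≤ normStable A Es * (ε * (d ^ α / m ^ α)) :=
      (hA.norm_map_stableProj_le _).trans (mul_le_mul_of_nonneg_left
        (h1.trans (mul_le_mul_of_nonneg_left hxy hε)) normStable_nonneg)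
    have hM : 0 ≤ max (δ * (1 + ε)) (2 * δ) := le_max_of_le_right (by linarith)
    have h2' := h2.trans (mul_le_mul_of_nonneg_left hxy hM)
    have h4 := (hA.norm_stableProj_le _).trans
      (norm_sub_le (h (a + v a) - h (b + v b)) (g a - g b))
    have h5 := mul_le_mul_of_nonneg_right hs.stable_le (Real.rpow_nonneg hd α)
    have h6 := norm_add_le (hA.stableProj (A (v a - v b)))
      (hA.stableProj (h (a + v a) - h (b + v b) - (g a - g b)))
    calc _ ≤ normStable A Es * (ε * (d ^ α / m ^ α))
          + (max (δ * (1 + ε)) (2 * δ) * (d ^ α / m ^ α) + max (δ / m) (2 * δ) * d ^ α) := by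
          linarith
      _ = (ε * normStable A Es / m ^ α + max (δ / m) (2 * δ)
          + max (δ * (1 + ε)) (2 * δ) / m ^ α) * d ^ α := by
          ring
      _ ≤ _ := h5
  · rw [map_sub, unstableProj_intertwiningOperator, unstableProj_intertwiningOperator, ← map_sub,
      ← map_sub]
    have e : g x + v (B x) - h (x + v x) - (g y + v (B y) - h (y + v y))
      = (g x - g y) + (v (B x) - v (B y)) - (h (x + v x) - h (y + v y)) := by abel
    rw [e]
    refine (hA.norm_symm_unstableProj_le _).trans ?_
    have h1 : ‖g x - g y‖ ≤ 2 * δ * d ^ α := by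
      have := norm_sub_le_rpow_of_mem_smallMaps (a := x) (b := y) (c := 1) hg hδ hα0.le hd
        fun h1 => by
          rw [one_mul]
          exact hle hd h1
      rwa [mul_one, max_eq_right (by linarith)] at this
    have hBxy : ‖B x - B y‖ ≤ (‖(A : E →L[𝕂] E)‖ + δ) * d := by
      have e : B x - B y = (A : E →L[𝕂] E) (x - y) + (g x - g y) := by
        rw [hB, hB, map_sub]
        simp only [ContinuousLinearEquiv.coe_coe]
        abel
      rw [e]
      have := norm_add_le ((A : E →L[𝕂] E) (x - y)) (g x - g y)
      have := (A : E →L[𝕂] E).le_opNorm (x - y)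
      have := hg.2 x y
      linarith
    have h2 : ‖v (B x) - v (B y)‖ ≤ ε * ((‖(A : E →L[𝕂] E)‖ + δ) ^ α * d ^ α) := by
      rw [← Real.mul_rpow (by positivity) hd]
      exact (hv _ _).trans (mul_le_mul_of_nonneg_left
        (Real.rpow_le_rpow (norm_nonneg _) hBxy hα0.le) hε)
    have h3 := hnl x y
    have h4 := (norm_sub_le ((g x - g y) + (v (B x) - v (B y)))
      (h (x + v x) - h (y + v y))).trans
      (add_le_add ((norm_add_le _ _).trans (add_le_add h1 h2)) h3)
    have h5 := mul_le_mul_of_nonneg_left h4 (normUnstable_nonneg (A := A) (Eu := Eu))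
    have h6 := mul_le_mul_of_nonneg_right hs.unstable_le (Real.rpow_nonneg hd α)
    refine h5.trans (le_trans (le_of_eq ?_) h6)
    ring

end Operator

theorem exists_intertwines [CompleteSpace E] [Nontrivial E] (hA : IsHyperbolic A Es Eu)
    {α ε δ : ℝ} (hs : IsSmall A Es Eu α ε δ) (hα0 : 0 < α) (hα1 : α < 1) (hε : 0 ≤ ε)
    (hδ : 0 ≤ δ) {g h : E → E} (hg : g ∈ smallMaps E δ) (hh : h ∈ smallMaps E δ) :
    ∃ v : E →ᵇ E, Intertwines A g h v ∧ ∀ x y, ‖v x - v y‖ ≤ ε * ‖x - y‖ ^ α := by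
  obtain ⟨B, hB, hB'⟩ := exists_homeomorph_add hδ hs.lt_inv_norm hg.2
  have hgc := continuous_of_norm_sub_le hg.2
  have hhc := continuous_of_norm_sub_le hh.2
  have hcont : ∀ v : E →ᵇ E, Continuous (intertwiningOperator hA B g h v) := fun v => by
    have := v.continuous
    have := B.continuous
    have := B.symm.continuous
    unfold intertwiningOperator
    fun_prop
  let Φ : (E →ᵇ E) → (E →ᵇ E) := fun v =>
    BoundedContinuousFunction.ofNormedAddCommGroup (intertwiningOperator hA B g h v) (hcont v) _
      (norm_intertwiningOperator_le hA B hg.1 hh.1 v.norm_coe_le_norm)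
  have hΦ : ContractingWith ⟨_, contractionFactor_nonneg (A := A) (Es := Es) (Eu := Eu) hδ⟩ Φ := by
    refine ⟨hs.contractionFactor_lt_one, LipschitzWith.of_dist_le_mul fun u v => ?_⟩
    refine (BoundedContinuousFunction.dist_le
      (mul_nonneg (NNReal.coe_nonneg _) dist_nonneg)).2 fun x => ?_
    rw [dist_eq_norm]
    refine (norm_intertwiningOperator_sub_le hA B hh.2 hδ (h' := h) (C := dist u v) (D := 0)
      (fun y => ?_) (fun y => by simp) x).trans (add_zero _).le
    rw [← dist_eq_norm]
    exact BoundedContinuousFunction.dist_coe_le_dist y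
  obtain ⟨v, hv, hlim, -⟩ := hΦ.exists_fixedPoint 0 (edist_ne_top _ _)
  refine ⟨v, (intertwines_iff_fixed hA hB).2 fun x => congrArg (fun u : E →ᵇ E => u x) hv,
    fun x y => ?_⟩
  -- The zero map satisfies the Hölder bound, hence so do all its iterates; pointwise limits
  -- preserve it.
  have hit : ∀ n x y, ‖(Φ^[n] 0) x - (Φ^[n] 0) y‖ ≤ ε * ‖x - y‖ ^ α := fun n => by
    induction n with
    | zero =>
      intro x y
      simpa using by positivity
    | succ n ih =>
      intro x y
      rw [Function.iterate_succ_apply']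
      exact norm_intertwiningOperator_sub_le_rpow hA hs hα0 hα1 hε hδ hg hh hB hB' ih x y
  have hev : ∀ z, Filter.Tendsto (fun n => (Φ^[n] 0) z) Filter.atTop (𝓝 (v z)) := fun z =>
    ((BoundedContinuousFunction.lipschitz_eval_const z).continuous.tendsto v).comp hlim
  exact le_of_tendsto ((hev x).sub (hev y)).norm (Filter.Eventually.of_forall fun n => hit n x y)

/-- Comparing two fixed points gives `‖u - v‖ ≤ θ ‖u - v‖ + D`. -/
theorem norm_sub_le_of_intertwines [CompleteSpace E] [Nontrivial E] (hA : IsHyperbolic A Es Eu)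
    {α ε δ : ℝ} (hs : IsSmall A Es Eu α ε δ) (hδ : 0 ≤ δ) {g h h' : E → E}
    (hg : g ∈ smallMaps E δ) (hh : h ∈ smallMaps E δ) {u v : E →ᵇ E}
    (hu : Intertwines A g h u) (hv : Intertwines A g h' v) {D : ℝ}
    (hD : ∀ x, ‖h x - h' x‖ ≤ D) :
    ‖u - v‖ ≤ D / (1 - contractionFactor A Es Eu δ) := by
  obtain ⟨B, hB, -⟩ := exists_homeomorph_add hδ hs.lt_inv_norm hg.2
  rw [le_div_iff₀ (sub_pos.2 hs.contractionFactor_lt_one)]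
  have hD0 : 0 ≤ D := (norm_nonneg _).trans (hD 0)
  have hθ := contractionFactor_nonneg (A := A) (Es := Es) (Eu := Eu) hδ
  have : ‖u - v‖ ≤ contractionFactor A Es Eu δ * ‖u - v‖ + D := by
    refine (BoundedContinuousFunction.norm_le (by positivity)).2 fun x => ?_
    rw [BoundedContinuousFunction.sub_apply, ← (intertwines_iff_fixed hA hB).1 hu x,
      ← (intertwines_iff_fixed hA hB).1 hv x]
    exact norm_intertwiningOperator_sub_le hA B hh.2 hδ (fun y => (u - v).norm_coe_le_norm y) hD x
  linarith

theorem eq_of_intertwines [CompleteSpace E] [Nontrivial E] (hA : IsHyperbolic A Es Eu)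
    {α ε δ : ℝ} (hs : IsSmall A Es Eu α ε δ) (hδ : 0 ≤ δ) {g h : E → E}
    (hg : g ∈ smallMaps E δ) (hh : h ∈ smallMaps E δ) {u v : E →ᵇ E}
    (hu : Intertwines A g h u) (hv : Intertwines A g h v) : u = v := by
  have := norm_sub_le_of_intertwines hA hs hδ hg hh hu hv (D := 0) (by simp)
  rw [zero_div] at this
  exact sub_eq_zero.1 (norm_le_zero_iff.1 this)

/-- The composite `(id + w) ∘ (id + v)` intertwines `A + g` with itself and differs from `id` by a
bounded map. So does `id`, and uniqueness identifies them. -/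
theorem add_apply_add_of_intertwines [CompleteSpace E] [Nontrivial E]
    (hA : IsHyperbolic A Es Eu) {α ε δ : ℝ} (hs : IsSmall A Es Eu α ε δ) (hδ : 0 ≤ δ)
    {g h : E → E} (hg : g ∈ smallMaps E δ) {v w : E →ᵇ E}
    (hv : Intertwines A g h v) (hw : Intertwines A h g w) (x : E) :
    (x + v x) + w (x + v x) = x := by
  let k : C(E, E) := ⟨fun x => x + v x, continuous_id.add v.continuous⟩
  have hu : Intertwines A g g (v + w.compContinuous k) := fun x => by
    have h1 := hw (x + v x)
    rw [hv x] at h1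
    simpa [k, ← add_assoc] using h1
  have h0 : Intertwines A g g (0 : E →ᵇ E) := fun x => by simp
  have h2 := congrArg (fun u : E →ᵇ E => u x) (eq_of_intertwines hA hs hδ hg hg
    (u := v + w.compContinuous k) hu h0)
  have h3 : v x + w (x + v x) = 0 := h2
  rw [add_assoc, h3, add_zero]

/-- If `h 0 = 0`, then the conjugating map fixes the origin. -/
theorem apply_zero_of_isConjugating (hA : IsHyperbolic A Es Eu) {α ε δ : ℝ}
    (hs : IsSmall A Es Eu α ε δ) {h v : E → E} (hh : h ∈ smallMaps E δ)
    (h0 : h 0 = 0) (hv : IsConjugating A h v) : v 0 = 0 := by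
  have hz := hv 0
  simp only [zero_add, map_zero] at hz
  have hhz : ‖h (v 0)‖ ≤ δ * ‖v 0‖ := by simpa [h0] using hh.2 (v 0) 0
  set z := v 0
  -- Here `z` is a fixed point of `A + h`. Since `h 0 = 0` gives `‖h z‖ ≤ δ ‖z‖`, hyperbolicity of
  -- `A` forces `‖z‖ ≤ θ ‖z‖`.
  have hle : ‖z‖ ≤ contractionFactor A Es Eu δ * ‖z‖ := by
    refine hA.norm_le_of_proj_le ?_ ?_
    · have e : hA.stableProj z = hA.stableProj (A z) + hA.stableProj (h z) := by
        rw [← map_add, hz]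
      rw [e]
      have h1 := (norm_add_le _ _).trans (add_le_add (hA.norm_map_stableProj_le z)
        ((hA.norm_stableProj_le (h z)).trans hhz))
      have h2 : (normStable A Es + δ) * ‖z‖ ≤ contractionFactor A Es Eu δ * ‖z‖ :=
        mul_le_mul_of_nonneg_right (le_max_right _ _) (norm_nonneg _)
      linarith
    · have e : hA.unstableProj z = A.symm (hA.unstableProj (z - h z)) := by
        rw [← hA.unstableProj_symm, ← eq_sub_of_add_eq hz, A.symm_apply_apply]
      rw [e]
      have h1 := (hA.norm_symm_unstableProj_le (z - h z)).trans (mul_le_mul_of_nonneg_left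
        ((norm_sub_le _ _).trans (add_le_add_right hhz ‖z‖)) normUnstable_nonneg)
      have h2 : (normUnstable A Eu * (1 + δ)) * ‖z‖ ≤ contractionFactor A Es Eu δ * ‖z‖ :=
        mul_le_mul_of_nonneg_right (le_max_left _ _) (norm_nonneg _)
      linarith
  by_contra hne
  have := norm_pos_iff.2 hne
  nlinarith [hs.contractionFactor_lt_one]

end GrobmanHartman

namespace GrobmanHartman

/-! ### The function `ω` -/

section Omega

variable {ε α : ℝ}

theorem omega_strictMonoOn (hε : 0 ≤ ε) (hα : 0 ≤ α) : StrictMonoOn (omega ε α) (Ici 0) := by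
  intro a ha b _ hab
  exact add_lt_add_of_lt_of_le hab
    (mul_le_mul_of_nonneg_left (Real.rpow_le_rpow ha hab.le hα) hε)

theorem omega_zero (hα : 0 < α) : omega ε α 0 = 0 := by
  simp [omega, Real.zero_rpow hα.ne']

theorem exists_omega_eq (hε : 0 ≤ ε) (hα : 0 < α) {t : ℝ} (ht : 0 ≤ t) :
    ∃ a ∈ Ici (0 : ℝ), omega ε α a = t := by
  have hc : ContinuousOn (omega ε α) (Icc 0 t) :=
    (continuous_id.add (continuous_const.mul (Real.continuous_rpow_const hα.le))).continuousOn
  have hmem : t ∈ Icc (omega ε α 0) (omega ε α t) := by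
    rw [omega_zero hα]
    exact ⟨ht, le_add_of_nonneg_right (mul_nonneg hε (Real.rpow_nonneg ht α))⟩
  obtain ⟨a, ha, h⟩ := intermediate_value_Icc ht hc hmem
  exact ⟨a, ha.1, h⟩

theorem omegaInv_nonneg (hε : 0 ≤ ε) (hα : 0 < α) {t : ℝ} (ht : 0 ≤ t) : 0 ≤ omegaInv ε α t :=
  Function.invFunOn_mem (exists_omega_eq hε hα ht)

theorem omega_omegaInv (hε : 0 ≤ ε) (hα : 0 < α) {t : ℝ} (ht : 0 ≤ t) :
    omega ε α (omegaInv ε α t) = t :=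
  Function.invFunOn_eq (exists_omega_eq hε hα ht)

theorem omega_lt_of_lt_omegaInv (hε : 0 ≤ ε) (hα : 0 < α) {a t : ℝ} (ht : 0 ≤ t) (ha : 0 ≤ a)
    (h : a < omegaInv ε α t) : omega ε α a < t := by
  rw [← omega_omegaInv hε hα ht]
  exact omega_strictMonoOn hε hα.le ha (omegaInv_nonneg hε hα ht) h

/-- The point is `‖x + v x‖ ≤ ‖x‖ + ε ‖x‖ ^ α = ω(‖x‖)`. -/
theorem mapsTo_ball_of_norm_sub_le_rpow {E : Type*} [NormedAddCommGroup E] {v : E → E}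
    (hε : 0 ≤ ε) (hα : 0 < α) (h0 : v 0 = 0) (hv : ∀ x y, ‖v x - v y‖ ≤ ε * ‖x - y‖ ^ α)
    {t : ℝ} (ht : 0 ≤ t) {x : E} (hx : x ∈ ball (0 : E) (omegaInv ε α t)) :
    x + v x ∈ ball (0 : E) t := by
  rw [mem_ball_zero_iff] at hx ⊢
  refine lt_of_le_of_lt ?_ (omega_lt_of_lt_omegaInv hε hα ht (norm_nonneg x) hx)
  refine (norm_add_le _ _).trans (add_le_add_right ?_ _)
  simpa [h0] using hv x 0

end Omega

/-! ### The cut-off nonlinearity -/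

namespace GroundCase

variable {𝕂 : Type*} [NontriviallyNormedField 𝕂] {E : Type*} [NormedAddCommGroup E]

theorem radius_pos (c : GroundCase 𝕂) {r : ℝ} (hr : 0 < r) : 0 < c.radius r := by
  cases c with
  | ultrametric h => exact hr
  | real e he η hη =>
    change 0 < r / 3
    positivity

theorem radius_le (c : GroundCase 𝕂) {r : ℝ} (hr : 0 ≤ r) : c.radius r ≤ r := by
  cases c with
  | ultrametric h => exact le_rfl
  | real e he η hη =>
    change r / 3 ≤ r
    linarith

theorem factor_eq_one (c : GroundCase 𝕂) {s : ℝ} (hs : 0 < s) {y : E} (hy : ‖y‖ ≤ s) :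
    c.factor s y = 1 := by
  cases c with
  | ultrametric h => rfl
  | real e he η hη =>
    change e.symm (η (‖y‖ / s).toNNReal) = 1
    rw [hη.eq_one _ (Real.toNNReal_le_one.2 ((div_le_one hs).2 hy)), map_one]

/-- In the real case the absolute value of `𝕂` need not be the usual one; the bound comes from
compactness of `[0, 1]` and continuity of `e.symm`. -/
theorem exists_norm_factor_le (c : GroundCase 𝕂) :
    ∃ C, 0 ≤ C ∧ ∀ (s : ℝ) (y : E), ‖c.factor s y‖ ≤ C := by
  cases c with
  | ultrametric h => exact ⟨1, zero_le_one, fun s y => norm_one.le⟩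
  | real e he η hη =>
    have hcont : Continuous e.symm := by
      have h := (he.homeomorph e).symm.continuous
      have heq : ((he.homeomorph e).symm : ℝ → 𝕂) = e.symm := by
        funext x
        rw [Homeomorph.symm_apply_eq]
        exact (e.apply_symm_apply x).symm
      rwa [heq] at h
    obtain ⟨C, hC⟩ := (isCompact_Icc.image hcont).isBounded.exists_norm_le (s := e.symm '' Icc 0 1)
    exact ⟨C, (norm_nonneg _).trans (hC (e.symm 0) ⟨0, by simp, rfl⟩),
      fun s y => hC _ ⟨_, hη.mem_Icc _, rfl⟩⟩

end GroundCase

section Cutoff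

variable {𝕂 E : Type*} [NontriviallyNormedField 𝕂] [NormedAddCommGroup E] [NormedSpace 𝕂 E]
variable {A : E ≃L[𝕂] E} {r : ℝ}

theorem zeroExtend_of_mem {f : ball (0 : E) r → E} {y : E} (hy : y ∈ ball (0 : E) r) :
    zeroExtend f y = f ⟨y, hy⟩ := dif_pos hy

theorem zeroExtend_of_notMem {f : ball (0 : E) r → E} {y : E} (hy : y ∉ ball (0 : E) r) :
    zeroExtend f y = 0 := dif_neg hy

theorem cutoff_of_notMem (c : GroundCase 𝕂) {f : ball (0 : E) r → E} {y : E}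
    (hy : y ∉ ball (0 : E) r) : cutoff c A f y = 0 := by
  rw [cutoff, zeroExtend_of_notMem hy, smul_zero]

theorem cutoff_of_mem (c : GroundCase 𝕂) {f : ball (0 : E) r → E} {y : E}
    (hy : y ∈ ball (0 : E) r) :
    cutoff c A f y = c.factor (c.radius r) y • nonlinearity A f ⟨y, hy⟩ := by
  rw [cutoff, zeroExtend_of_mem hy]

theorem map_add_cutoff (c : GroundCase 𝕂) (hr : 0 < r) {f : ball (0 : E) r → E} {y : E}
    (hy : y ∈ ball (0 : E) (c.radius r)) (hy' : y ∈ ball (0 : E) r) :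
    A y + cutoff c A f y = f ⟨y, hy'⟩ := by
  rw [cutoff_of_mem c hy',
    c.factor_eq_one (c.radius_pos hr) (mem_ball_zero_iff.1 hy).le, one_smul, nonlinearity]
  exact add_sub_cancel _ _

theorem norm_cutoff_sub_le (c : GroundCase 𝕂) {C : ℝ} (hC : 0 ≤ C)
    (hfac : ∀ (s : ℝ) (y : E), ‖c.factor s y‖ ≤ C) (f f' : ball (0 : E) r →ᵇ E) (y : E) :
    ‖cutoff c A f y - cutoff c A f' y‖ ≤ C * dist f f' := by
  by_cases hy : y ∈ ball (0 : E) r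
  · rw [cutoff_of_mem c hy, cutoff_of_mem c hy, ← smul_sub, norm_smul]
    refine mul_le_mul (hfac _ _) ?_ (norm_nonneg _) hC
    rw [nonlinearity, nonlinearity, sub_sub_sub_cancel_right, ← dist_eq_norm]
    exact BoundedContinuousFunction.dist_coe_le_dist _
  · rw [cutoff_of_notMem c hy, cutoff_of_notMem c hy, sub_self, norm_zero]
    exact mul_nonneg hC dist_nonneg

section LocalMaps

variable {c : GroundCase 𝕂} {δ : ℝ} {f : ball (0 : E) r →ᵇ E}

theorem nonlinearity_zero (hr : 0 < r) (hf : f ∈ localMaps c A r δ) :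
    nonlinearity A f ⟨0, mem_ball_self hr⟩ = 0 := by
  have h := hf.1
  rw [zeroExtend_of_mem (mem_ball_self hr)] at h
  simp [nonlinearity, h]

theorem norm_nonlinearity_le (hr : 0 < r) (hf : f ∈ localMaps c A r δ) (y : ball (0 : E) r) :
    ‖nonlinearity A f y‖ ≤ c.lipBound δ * ‖(y : E)‖ := by
  simpa [nonlinearity_zero hr hf] using hf.2.2 y ⟨0, mem_ball_self hr⟩

theorem cutoff_zero (hr : 0 < r) (hf : f ∈ localMaps c A r δ) : cutoff c A f 0 = 0 := by
  rw [cutoff_of_mem c (mem_ball_self hr), nonlinearity_zero hr hf, smul_zero]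

end LocalMaps

theorem norm_sub_le_of_lipschitz_extension {g : E → E} {δ : ℝ}
    (hin : ∀ x ∈ ball (0 : E) r, ∀ y ∈ ball (0 : E) r, ‖g x - g y‖ ≤ δ * ‖x - y‖)
    (hio : ∀ x ∈ ball (0 : E) r, ∀ y ∉ ball (0 : E) r, ‖g x‖ ≤ δ * ‖x - y‖)
    (hout : ∀ y ∉ ball (0 : E) r, g y = 0) (hδ : 0 ≤ δ) (x y : E) :
    ‖g x - g y‖ ≤ δ * ‖x - y‖ := by
  by_cases hx : x ∈ ball (0 : E) r <;> by_cases hy : y ∈ ball (0 : E) r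
  · exact hin x hx y hy
  · rw [hout y hy, sub_zero]
    exact hio x hx y hy
  · rw [hout x hx, zero_sub, norm_neg, norm_sub_rev]
    exact hio y hy x hx
  · rw [hout x hx, hout y hy, sub_self, norm_zero]
    positivity

theorem cutoff_mem_smallMaps_of_ultrametric [IsUltrametricDist E] (h : IsUltrametricDist 𝕂)
    {δ : ℝ} (hδ : 0 ≤ δ) (hr : 0 < r) (hr1 : r ≤ 1) {f : ball (0 : E) r →ᵇ E}
    (hf : f ∈ localMaps (.ultrametric h) A r δ) :
    cutoff (.ultrametric h) A f ∈ smallMaps E δ := by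
  have hval : ∀ {y} (hy : y ∈ ball (0 : E) r),
      cutoff (.ultrametric h) A f y = nonlinearity A f ⟨y, hy⟩ := fun hy => by
    rw [cutoff_of_mem _ hy]
    exact one_smul 𝕂 _
  have hle : ∀ y ∈ ball (0 : E) r, ‖cutoff (.ultrametric h) A f y‖ ≤ δ * ‖y‖ := fun y hy => by
    rw [hval hy]
    exact norm_nonlinearity_le hr hf ⟨y, hy⟩
  refine ⟨fun y => ?_, norm_sub_le_of_lipschitz_extension (r := r) ?_ ?_
    (fun y hy => cutoff_of_notMem _ hy) hδ⟩
  · by_cases hy : y ∈ ball (0 : E) r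
    · have := mem_ball_zero_iff.1 hy
      exact (hle y hy).trans (mul_le_of_le_one_right hδ (by linarith))
    · rw [cutoff_of_notMem _ hy, norm_zero]
      exact hδ
  · intro x hx y hy
    rw [hval hx, hval hy]
    exact hf.2.2 ⟨x, hx⟩ ⟨y, hy⟩
  · intro x hx y hy
    refine (hle x hx).trans (mul_le_mul_of_nonneg_left ?_ hδ)
    rw [mem_ball_zero_iff] at hx hy
    have hlt : ‖x‖ < ‖y‖ := hx.trans_le (not_lt.1 hy)
    -- Since `‖y‖ ≤ max ‖x - y‖ ‖x‖` and `‖x‖ < ‖y‖`, the maximum must be `‖x - y‖`, so `‖x‖ ≤ ‖x -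
    -- y‖`.
    have := IsUltrametricDist.norm_add_le_max (x - y) (-x)
    rw [(by abel : x - y + -x = -y), norm_neg, norm_neg] at this
    rcases le_max_iff.1 this with h1 | h1 <;> linarith

/-- By the product rule, `Lip(ξ R_f)` is at most `ρ + (3L / r) (ρ r) = ρ (1 + 3L) = δ`: the factor
`ξ` has Lipschitz constant at most `L / s = 3L / r`, and `‖R_f‖ ≤ ρ r` on the ball. -/
theorem cutoff_mem_smallMaps_of_real {e : 𝕂 ≃+* ℝ} (he : IsHomeomorph e) {η : ℝ≥0 → ℝ}
    (hη : IsCutoffProfile η) (hnorm : ∀ x : 𝕂, ‖x‖ = |e x|)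
    {δ : ℝ} (hδ : 0 ≤ δ) (hr : 0 < r) (hr1 : r ≤ 1) {f : ball (0 : E) r →ᵇ E}
    (hf : f ∈ localMaps (.real e he η hη) A r δ) :
    cutoff (.real e he η hη) A f ∈ smallMaps E δ := by
  set c : GroundCase 𝕂 := .real e he η hη
  have hL0 : 0 ≤ holderConst 1 η := holderConst_nonneg 1 η
  have hLip := holderBound_holderConst hη.lipschitz
  set L := holderConst 1 η
  set ρ := c.lipBound δ
  have hρ : ρ * (1 + 3 * L) = δ := div_mul_cancel₀ δ (by positivity)
  have hρ0 : 0 ≤ ρ := div_nonneg hδ (by positivity)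
  let ξ : E → 𝕂 := c.factor (c.radius r)
  have hξ : ∀ y, e (ξ y) = η (‖y‖ / (r / 3)).toNNReal := fun y => e.apply_symm_apply _
  have hξ1 : ∀ y, ‖ξ y‖ ≤ 1 := fun y => by
    rw [hnorm, hξ, abs_of_nonneg (hη.mem_Icc _).1]
    exact (hη.mem_Icc _).2
  have hξL : ∀ x y, ‖ξ x - ξ y‖ * r ≤ 3 * L * ‖x - y‖ := fun x y => by
    rw [hnorm, map_sub, hξ, hξ, ← Real.dist_eq]
    have h1 := hLip (‖x‖ / (r / 3)).toNNReal (‖y‖ / (r / 3)).toNNReal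
    rw [Real.rpow_one, NNReal.dist_eq, Real.coe_toNNReal _ (by positivity),
      Real.coe_toNNReal _ (by positivity), ← sub_div, abs_div,
      abs_of_pos (by positivity : 0 < r / 3)] at h1
    have h2 : |‖x‖ - ‖y‖| / (r / 3) ≤ ‖x - y‖ / (r / 3) :=
      div_le_div_of_nonneg_right (abs_norm_sub_norm_le x y) (by positivity)
    calc _ ≤ L * (‖x - y‖ / (r / 3)) * r :=
          mul_le_mul_of_nonneg_right (h1.trans (mul_le_mul_of_nonneg_left h2 hL0)) hr.le
      _ = 3 * L * ‖x - y‖ := by field_simp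
  have hξ0 : ∀ y ∉ ball (0 : E) r, ξ y = 0 := fun y hy => by
    rw [mem_ball_zero_iff, not_lt] at hy
    apply e.injective
    rw [hξ, map_zero]
    refine hη.eq_zero _ ((Real.le_toNNReal_iff_coe_le (by positivity)).2 ?_)
    rw [le_div_iff₀ (by positivity)]
    push_cast
    linarith
  have hR : ∀ y : ball (0 : E) r, ‖nonlinearity A f y‖ ≤ ρ * r := fun y =>
    (norm_nonlinearity_le hr hf y).trans
      (mul_le_mul_of_nonneg_left (mem_ball_zero_iff.1 y.2).le hρ0)
  have hval : ∀ {y} (hy : y ∈ ball (0 : E) r),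
      cutoff c A f y = ξ y • nonlinearity A f ⟨y, hy⟩ := fun hy => cutoff_of_mem c hy
  have hprod : ∀ (x y : E) (z : ball (0 : E) r),
      ‖(ξ x - ξ y) • nonlinearity A f z‖ ≤ ρ * (3 * L) * ‖x - y‖ := fun x y z => by
    rw [norm_smul]
    calc _ ≤ ‖ξ x - ξ y‖ * (ρ * r) := mul_le_mul_of_nonneg_left (hR z) (norm_nonneg _)
      _ = ρ * (‖ξ x - ξ y‖ * r) := by ring
      _ ≤ ρ * (3 * L * ‖x - y‖) := mul_le_mul_of_nonneg_left (hξL x y) hρ0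
      _ = _ := by ring
  refine ⟨fun y => ?_, norm_sub_le_of_lipschitz_extension (r := r) ?_ ?_
    (fun y hy => cutoff_of_notMem c hy) hδ⟩
  · by_cases hy : y ∈ ball (0 : E) r
    · rw [hval hy, norm_smul]
      have h1 := mul_le_mul (hξ1 y) (hR ⟨y, hy⟩) (norm_nonneg _) zero_le_one
      have h2 : ρ * r ≤ ρ * 1 := mul_le_mul_of_nonneg_left hr1 hρ0
      have h3 : 0 ≤ ρ * (3 * L) := by positivity
      linarith
    · rw [cutoff_of_notMem c hy, norm_zero]
      exact hδ
  · intro x hx y hy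
    rw [hval hx, hval hy]
    have e1 : ξ x • nonlinearity A f ⟨x, hx⟩ - ξ y • nonlinearity A f ⟨y, hy⟩
      = ξ x • (nonlinearity A f ⟨x, hx⟩ - nonlinearity A f ⟨y, hy⟩)
        + (ξ x - ξ y) • nonlinearity A f ⟨y, hy⟩ := by
      rw [smul_sub, sub_smul]
      abel
    rw [e1]
    have h1 : ‖ξ x • (nonlinearity A f ⟨x, hx⟩ - nonlinearity A f ⟨y, hy⟩)‖
        ≤ 1 * (ρ * ‖x - y‖) := by
      rw [norm_smul]
      exact mul_le_mul (hξ1 x) (hf.2.2 ⟨x, hx⟩ ⟨y, hy⟩) (norm_nonneg _) zero_le_one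
    refine (norm_add_le _ _).trans ((add_le_add h1 (hprod x y ⟨y, hy⟩)).trans (le_of_eq ?_))
    rw [← hρ]
    ring
  · intro x hx y hy
    -- As `ξ y = 0`, the value at `x` equals `(ξ x - ξ y) • R_f(x)`.
    have h1 := hprod x y ⟨x, hx⟩
    rw [hξ0 y hy, sub_zero, ← hval hx] at h1
    refine h1.trans (mul_le_mul_of_nonneg_right ?_ (norm_nonneg _))
    linarith

end Cutoff

/-! ### Interpolation between the supremum norm and Hölder norms -/

theorem HolderBound.continuous {X Y : Type*} [PseudoMetricSpace X] [PseudoMetricSpace Y]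
    {L γ : ℝ} {f : X → Y} (h : HolderBound L γ f) (hγ : 0 < γ) : Continuous f := by
  refine continuous_iff_continuousAt.2 fun x => tendsto_iff_dist_tendsto_zero.2 ?_
  have hlim : Filter.Tendsto (fun y => L * dist y x ^ γ) (𝓝 x) (𝓝 (L * dist x x ^ γ)) :=
    ((continuous_const.mul ((continuous_id.dist continuous_const).rpow_const
      fun _ => Or.inr hγ.le))).tendsto x
  rw [dist_self, Real.zero_rpow hγ.ne', mul_zero] at hlim
  exact squeeze_zero (fun _ => dist_nonneg) (fun y => h y x) hlim

/-- Write `q = q ^ (β / α) * q ^ (1 - β / α)` and use one bound in each factor. -/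
theorem le_rpow_mul_rpow_of_le {α β K M q d : ℝ} (hβ : 0 < β) (hβα : β < α) (hK : 0 ≤ K)
    (hq : 0 ≤ q) (hd : 0 ≤ d) (h1 : q ≤ K * d ^ α) (h2 : q ≤ M) :
    q ≤ K ^ (β / α) * M ^ (1 - β / α) * d ^ β := by
  have hα : 0 < α := hβ.trans hβα
  have hθ0 : 0 ≤ β / α := by positivity
  have hθ1 : 0 ≤ 1 - β / α := by
    rw [sub_nonneg, div_le_one hα]
    exact hβα.le
  calc q = q ^ (β / α) * q ^ (1 - β / α) := by
        rw [← Real.rpow_add_of_nonneg hq hθ0 hθ1, add_sub_cancel, Real.rpow_one]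
    _ ≤ (K * d ^ α) ^ (β / α) * M ^ (1 - β / α) := by gcongr
    _ = K ^ (β / α) * M ^ (1 - β / α) * d ^ β := by
        rw [Real.mul_rpow hK (by positivity), ← Real.rpow_mul hd, mul_div_cancel₀ _ hα.ne']
        ring

/-- Differences `v f - v f₀` are `α`-Hölder with the uniform constant `2K`. Interpolation bounds
their `β`-seminorm by a multiple of a positive power of the supremum norm, which tends to `0`. -/
theorem exists_continuous_restrict_BL {T E : Type*} [TopologicalSpace T] [NormedAddCommGroup E]
    {v : T → (E →ᵇ E)} (hv : Continuous v) {α K : ℝ} (hK : 0 ≤ K)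
    (hvK : ∀ f x y, ‖v f x - v f y‖ ≤ K * ‖x - y‖ ^ α) {β : ℝ} (hβ : 0 < β) (hβα : β < α)
    (t : ℝ) :
    ∃ V : T → BL β (ball (0 : E) t) E, (∀ f y, (V f).toBC y = v f y) ∧ Continuous V := by
  let ι : C(ball (0 : E) t, E) := ⟨Subtype.val, continuous_subtype_val⟩
  have interp : ∀ (u : E →ᵇ E) (L : ℝ), 0 ≤ L → (∀ x y, ‖u x - u y‖ ≤ L * ‖x - y‖ ^ α) →
      HolderBound (L ^ (β / α) * (2 * ‖u‖) ^ (1 - β / α)) β (u.compContinuous ι) :=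
    fun u L hL hu x y => by
      rw [dist_eq_norm, Subtype.dist_eq, dist_eq_norm]
      refine le_rpow_mul_rpow_of_le hβ hβα hL (norm_nonneg _) (norm_nonneg _) (hu x y) ?_
      have := norm_sub_le (u x) (u y)
      have := u.norm_coe_le_norm x
      have := u.norm_coe_le_norm y
      change ‖u x - u y‖ ≤ _
      linarith
  let V : T → BL β (ball (0 : E) t) E := fun f =>
    ⟨(v f).compContinuous ι, _, interp (v f) K hK (hvK f)⟩
  refine ⟨V, fun f y => rfl, continuous_iff_continuousAt.2 fun f₀ => ?_⟩
  refine tendsto_iff_norm_sub_tendsto_zero.2 ?_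
  have hn : Continuous fun f => ‖v f - v f₀‖ := (hv.sub continuous_const).norm
  have hθ : 0 < 1 - β / α := by
    rw [sub_pos, div_lt_one (hβ.trans hβα)]
    exact hβα
  have hlim : Filter.Tendsto (fun f => max ‖v f - v f₀‖
      ((2 * K) ^ (β / α) * (2 * ‖v f - v f₀‖) ^ (1 - β / α))) (𝓝 f₀) (𝓝 0) := by
    have hc : Continuous fun f => max ‖v f - v f₀‖
        ((2 * K) ^ (β / α) * (2 * ‖v f - v f₀‖) ^ (1 - β / α)) :=
      hn.max (continuous_const.mul ((continuous_const.mul hn).rpow_const fun _ => Or.inr hθ.le))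
    have := hc.tendsto f₀
    rwa [sub_self, norm_zero, mul_zero, Real.zero_rpow hθ.ne', mul_zero, max_self] at this
  refine squeeze_zero (fun _ => norm_nonneg _) (fun f => ?_) hlim
  have hsub : (V f - V f₀).toBC = (v f - v f₀).compContinuous ι := rfl
  rw [BL.norm_def, hsub]
  refine max_le_max ?_ (holderConst_le (by positivity) (interp _ _ (by positivity) fun x y => ?_))
  · exact (BoundedContinuousFunction.norm_le (norm_nonneg _)).2
      fun y => (v f - v f₀).norm_coe_le_norm (y : E)
  · rw [BoundedContinuousFunction.sub_apply, BoundedContinuousFunction.sub_apply,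
      sub_sub_sub_comm]
    have := norm_sub_le (v f x - v f y) (v f₀ x - v f₀ y)
    have := hvK f x y
    have := hvK f₀ x y
    linarith

/-- Two maps `id + w` and `id + w'` inverse to `id + v` and `id + v'` are close if `v` and `v'`
are. -/
theorem norm_inverse_sub_le {E : Type*} [NormedAddCommGroup E] {α ε : ℝ}
    {v v' w w' : E →ᵇ E} (hα : 0 ≤ α) (hε : 0 ≤ ε)
    (hwv : ∀ x, (x + w x) + v (x + w x) = x) (hvw : ∀ x, (x + v' x) + w' (x + v' x) = x)
    (hw' : ∀ x y, ‖w' x - w' y‖ ≤ ε * ‖x - y‖ ^ α) :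
    ‖w - w'‖ ≤ ‖v' - v‖ + ε * ‖v' - v‖ ^ α := by
  refine (BoundedContinuousFunction.norm_le (by positivity)).2 fun x => ?_
  set y := x + w x
  have h4 : v y = x - y := eq_sub_of_add_eq' (hwv x)
  have hy : y + v' y = x + (v' - v) y := by
    rw [BoundedContinuousFunction.sub_apply, h4]
    abel
  -- Both `v y = -w x` and `w' (y + v' y) = -v' y` come from the inverse relations; as `y + v' y = x
  -- + (v' - v) y`, the Hölder bound on `w'` applies.
  have h1 : (w - w') x = (v' - v) y + (w' (y + v' y) - w' x) := by
    have h3 : w x = y - x := by simp [y]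
    have h5 : w' (y + v' y) = -(v' y) := by
      have := hvw y
      rw [add_assoc, add_eq_left] at this
      exact eq_neg_of_add_eq_zero_right this
    simp only [BoundedContinuousFunction.sub_apply, h3, h4, h5]
    abel
  rw [h1]
  have hn := (v' - v).norm_coe_le_norm y
  refine (norm_add_le _ _).trans (add_le_add hn ((hw' _ _).trans ?_))
  rw [hy, add_sub_cancel_left]
  gcongr

end GrobmanHartman

open GrobmanHartman
-- The conjugacy theorem
theorem proposition7p8 {𝕂 E : Type*} [NontriviallyNormedField 𝕂] [NormedAddCommGroup E]
    [NormedSpace 𝕂 E] [CompleteSpace E] [Nontrivial E]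
    (c : GroundCase 𝕂) (A : E ≃L[𝕂] E) (Es Eu : Submodule 𝕂 E) (hA : IsHyperbolic A Es Eu)
    (α ε δ : ℝ) (hα0 : 0 < α) (hα1 : α < 1) (hε : 0 < ε) (hδ : 0 < δ)
    (hsmall : IsSmall A Es Eu α ε δ) (r : ℝ) (hr : 0 < r) :
    (r ≤ 1 → c.IsStandard E → admissibleMaps c A r δ = localMaps c A r δ) ∧
    ∃ v w : admissibleMaps c A r δ → (E →ᵇ E),
      (∀ f, IsConjugating A (cutoff c A f.1) (v f) ∧
        ∀ u : E →ᵇ E, IsConjugating A (cutoff c A f.1) u → u = v f) ∧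
      (∀ f, ∃ H : E ≃ₜ E,
        (∀ x, H x = x + v f x) ∧ (∀ x, H.symm x = x + w f x) ∧
        ball 0 (omegaInv ε α (omegaInv ε α (c.radius r)))
          ⊆ H '' ball 0 (omegaInv ε α (c.radius r)) ∧
        H '' ball 0 (omegaInv ε α (c.radius r)) ⊆ ball 0 (c.radius r) ∧
        (∀ x ∈ ball (0 : E) (omegaInv ε α (c.radius r)),
          ∃ hx : H x ∈ ball (0 : E) r, f.1 ⟨H x, hx⟩ = H (A x)) ∧
        H 0 = 0) ∧
      (∃ L, HolderBound L 1 v) ∧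
      (∃ L, HolderBound L α w) ∧
      (LocallyCompactSpace 𝕂 → FiniteDimensional 𝕂 E → ∀ β, 0 < β → β < α → ∀ t, 0 < t →
        ∃ V W : admissibleMaps c A r δ → BL β (ball (0 : E) t) E,
          (∀ f y, (V f).toBC y = v f y) ∧ (∀ f y, (W f).toBC y = w f y) ∧
          Continuous V ∧ Continuous W) := by
  refine ⟨fun hr1 hstd => ?_, ?_⟩
  · refine Subset.antisymm (fun f hf => hf.1) fun f hf => ⟨hf, ?_⟩
    cases c with
    | ultrametric h =>
      have : IsUltrametricDist E := hstd
      exact cutoff_mem_smallMaps_of_ultrametric h hδ.le hr hr1 hf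
    | real e he η hη => exact cutoff_mem_smallMaps_of_real he hη hstd hδ.le hr hr1 hf
  have hzero := zero_mem_smallMaps (E := E) hδ.le
  have hgf : ∀ f : admissibleMaps c A r δ, cutoff c A f.1 ∈ smallMaps E δ := fun f => f.2.2
  choose v hv hvε using fun f : admissibleMaps c A r δ =>
    exists_intertwines hA hsmall hα0 hα1 hε.le hδ.le hzero (hgf f)
  choose w hw hwε using fun f : admissibleMaps c A r δ =>
    exists_intertwines hA hsmall hα0 hα1 hε.le hδ.le (hgf f) hzero
  have hvw := fun f => add_apply_add_of_intertwines hA hsmall hδ.le hzero (hv f) (hw f)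
  have hwv := fun f => add_apply_add_of_intertwines hA hsmall hδ.le (hgf f) (hw f) (hv f)
  have hv0 : ∀ f, v f 0 = 0 := fun f =>
    apply_zero_of_isConjugating hA hsmall (hgf f) (cutoff_zero hr f.2.1)
      (isConjugating_iff_intertwines.2 (hv f))
  have hw0 : ∀ f, w f 0 = 0 := fun f => by simpa [hv0 f] using hvw f 0
  have hθ := sub_pos.2 hsmall.contractionFactor_lt_one
  set θ := contractionFactor A Es Eu δ
  obtain ⟨C, hC0, hC⟩ := c.exists_norm_factor_le (E := E)
  have hvLip : HolderBound (C / (1 - θ)) 1 v := fun f f' => by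
    rw [Real.rpow_one, dist_eq_norm, div_mul_eq_mul_div]
    exact norm_sub_le_of_intertwines hA hsmall hδ.le hzero (hgf f) (hv f) (hv f')
      fun x => norm_cutoff_sub_le c hC0 hC _ _ x
  -- Comparison with the perturbation `0`, whose solution is `0`.
  have hvb : ∀ f, ‖v f‖ ≤ δ / (1 - θ) := fun f => by
    have h0 : Intertwines A 0 0 (0 : E →ᵇ E) := fun x => by simp
    have := norm_sub_le_of_intertwines hA hsmall hδ.le hzero (hgf f) (hv f) h0 (D := δ)
      fun x => by simpa using (hgf f).1 x
    rwa [sub_zero] at this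
  -- The inverse estimate is `D + ε D ^ α` with `D = ‖v f' - v f‖`. As `D ≤ 2 (δ / (1 - θ))`, the
  -- linear term is at most `(2 (δ / (1 - θ))) ^ (1 - α) * D ^ α`.
  have hwHol : HolderBound (((2 * (δ / (1 - θ))) ^ (1 - α) + ε) * (C / (1 - θ)) ^ α) α w :=
    fun f f' => by
      have h1 := norm_inverse_sub_le hα0.le hε.le (hwv f) (hvw f') (hwε f')
      set D := ‖v f' - v f‖
      have hD : 0 ≤ D := norm_nonneg _
      have hD1 : D ≤ C / (1 - θ) * dist f f' := by
        have := hvLip f f'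
        rwa [Real.rpow_one, dist_comm, dist_eq_norm] at this
      have hD2 : D ≤ 2 * (δ / (1 - θ)) := by
        have := (norm_sub_le (v f') (v f)).trans (add_le_add (hvb f') (hvb f))
        linarith
      have hD3 : D = D ^ (1 - α) * D ^ α := by
        rw [← Real.rpow_add_of_nonneg hD (by linarith) hα0.le, sub_add_cancel, Real.rpow_one]
      have hα1' : 0 ≤ 1 - α := by linarith
      rw [dist_eq_norm, mul_assoc, ← Real.mul_rpow (by positivity) dist_nonneg]
      calc _ ≤ D + ε * D ^ α := h1
        _ = (D ^ (1 - α) + ε) * D ^ α := by rw [add_mul, ← hD3]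
        _ ≤ _ := by gcongr
  refine ⟨v, w, fun f => ⟨isConjugating_iff_intertwines.2 (hv f), fun u hu => ?_⟩, fun f => ?_,
    ⟨_, hvLip⟩, ⟨_, hwHol⟩, fun _ _ β hβ hβα t _ => ?_⟩
  · exact eq_of_intertwines hA hsmall hδ.le hzero (hgf f) (isConjugating_iff_intertwines.1 hu)
      (hv f)
  · have hs := c.radius_pos hr
    have hU := omegaInv_nonneg hε.le hα0 hs.le
    let H : E ≃ₜ E :=
      { toFun := fun x => x + v f x
        invFun := fun x => x + w f x
        left_inv := hvw f
        right_inv := hwv f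
        continuous_toFun := continuous_id.add (v f).continuous
        continuous_invFun := continuous_id.add (w f).continuous }
    have hHO : ∀ x ∈ ball (0 : E) (omegaInv ε α (c.radius r)), H x ∈ ball (0 : E) (c.radius r) :=
      fun x hx => mapsTo_ball_of_norm_sub_le_rpow hε.le hα0 (hv0 f) (hvε f) hs.le hx
    refine ⟨H, fun x => rfl, fun x => rfl, fun x hx => ?_, image_subset_iff.2 hHO,
      fun x hx => ?_, ?_⟩
    -- The inverse `id + w f` obeys the same Hölder bound, so it maps `W` into `U`; this is why `W`
    -- involves `ω⁻¹` twice.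
    · exact ⟨H.symm x, mapsTo_ball_of_norm_sub_le_rpow hε.le hα0 (hw0 f) (hwε f) hU hx,
        H.apply_symm_apply x⟩
    · have hr' := ball_subset_ball (c.radius_le hr.le) (hHO x hx)
      refine ⟨hr', ?_⟩
      -- On `B_s` the cut-off factor is `1`, so `A + g_f` agrees with `f` at `H x`.
      refine (map_add_cutoff (A := A) (f := f.1) c hr (hHO x hx) hr').symm.trans ?_
      exact isConjugating_iff_intertwines.2 (hv f) x
    · change 0 + v f 0 = 0
      rw [hv0, add_zero]
  · obtain ⟨V, hV, hVc⟩ := exists_continuous_restrict_BL (hvLip.continuous one_pos) hε.le hvε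
      hβ hβα t
    obtain ⟨W, hW, hWc⟩ := exists_continuous_restrict_BL (hwHol.continuous hα0) hε.le hwε
      hβ hβα t
    exact ⟨V, W, hV, hW, hVc, hWc⟩
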